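/- For a function $f$ let $\Delta f(x)=f(x+1)-f(x)$, so that $\Delta^n f(x)=\sum_{\nu=0}^n(-1)^{n-\nu}\binom n\nu f(x+\nu)$. Put $$a_n=\frac{(-1)^{n+1}}{2^n}\,\Delta^n\log x\,\Big|_{x=1}\quad(n\ge 1),\qquad L^*(f)=\sum_{n\ge1}a_n f(n)\quad(f\in\mathbb C[x]),$$ and, for $n\ge1$, $$p_n(x)=\sum_{\nu=0}^n(-1)^\nu 2^{n-\nu}\binom{x+\nu}{\nu}\,\Delta^\nu (x+1)^n\in\mathbb Q[x].$$ The series $L^*(f)$ converges absolutely for every $f\in\mathbb C[x]$, and the following hold. (1) For every even integer $n\ge2$ one has $p_n'(0)\ne0$ and $$\frac{\zeta(n+1)}{\zeta(n)}=\Big(1-\frac1n\Big)\Big(1-\frac1{2^{n+1}-1}\Big)\frac{L^*(p_n)}{p_n'(0)}.$$ (2) $\displaystyle\lim_{n\to\infty,\;2\mid n}\frac{L^*(p_n)}{p_n'(0)}=1.$ (3) Let $N\ge1$, let $\alpha_1,\dots,\alpha_N$ be nonzero rational numbers and let $n_1<\dots<n_N$ be positive even integers. Then there is a polynomial $q\in\mathbb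 Q[x]$ of degree $n_N$ with $$\sum_{j=1}^N\alpha_j\,\frac{\zeta(n_j+1)}{\zeta(n_j)}=L^*(q).$$ -/

import Mathlib

open Polynomial Filter Topology

noncomputable section

namespace QuotZeta

/-- The coefficients `a_n = ((-1)^(n+1) / 2^n) * (Δ^n log)(1)`, where `Δ` is the forward
difference operator with step `1`. -/
def a (n : ℕ) : ℝ :=
  (-1) ^ (n + 1) / 2 ^ n * (fwdDiff (1 : ℝ))^[n] Real.log 1

/-- The linear functional `L*(f) = ∑_{n ≥ 1} a_n f(n)` on complex polynomials
(the sum is indexed by `n + 1` with `n ≥ 0`). -/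
def LStar (f : ℂ[X]) : ℂ :=
  ∑' n : ℕ, (a (n + 1) : ℂ) * f.eval ((n + 1 : ℕ) : ℂ)

/-- The binomial coefficient `binom(x + ν, ν) = (x + ν)(x + ν - 1) ⋯ (x + 1) / ν!`
as a polynomial in `x`. -/
def binomPoly (ν : ℕ) : ℚ[X] :=
  C ((ν.factorial : ℚ)⁻¹) * (descPochhammer ℚ ν).comp (X + (ν : ℚ[X]))

/-- The polynomial `Δ^ν (x + 1)^n` in `x`: the `ν`-th forward difference of `y ↦ (y + 1)^n`
at the indeterminate `y = X`. -/
def diffPow (ν n : ℕ) : ℚ[X] :=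
  (fwdDiff (1 : ℚ[X]))^[ν] (fun y => (y + 1) ^ n) X

/-- The polynomials `p_n(x) = ∑_{ν=0}^n (-1)^ν 2^(n-ν) binom(x + ν, ν) Δ^ν (x + 1)^n`. -/
def p (n : ℕ) : ℚ[X] :=
  ∑ ν ∈ Finset.range (n + 1), (-1) ^ ν * 2 ^ (n - ν) * binomPoly ν * diffPow ν n

/-- `L*(f)` for a rational polynomial `f`, viewed as a complex polynomial. -/
def LStarRat (f : ℚ[X]) : ℂ := LStar (f.map (algebraMap ℚ ℂ))

/-- The derivative `p_n'(0)`, a rational number. -/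
def dpZero (n : ℕ) : ℚ := (derivative (p n)).eval 0

end QuotZeta

end

/-! Write `D_m(s) = ∑ (-1)^k binom(m,k) (k+1)^(-s)` and attach to a polynomial `f` the function
`B_f(s) = ∑ 2^(-m) f(m) D_m(s)`. Since `D_m` grows at most polynomially in `m` on discs, `B_f` is
entire. Moreover `B_f(0) = f(0)` and `B_f'(0) = L*(f)`, because `D_m'(0) = 2^m a_m`. For `f = 1`
this is Euler's transform of the alternating zeta series, so `B_1(s) = 2(1 - 2^(1-s)) ζ(s)`.

The recurrence `D_m(s-1) = (m+1) D_m(s) - m D_{m-1}(s)` and summation by parts turn the shift `s ↦ s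
- 1` into the operator `T f = (X+1)(2f - f(X+1))`, and `p_{n+1} = T p_n` (`p_succ`). Hence
`B_{p_n}(s) = 2^n B_1(s-n)` (`binomTransform_pComplex`). Its value at `0` gives `p_n(0)` through
`ζ(-n)`; for even `n ≥ 2`, where `ζ(-n) = 0`, its derivative at `0` gives `L*(p_n)` through
`ζ'(-n)`.

With `G = 2/(1+e^(-w))`, the same recurrence shows that `G^(x+1)` generates `p_n(x)/(2^n n!)`, and
the reflection `w ↦ -w` yields `p_n'(0) = (n-1) p_{n-1}(0)` for even `n` (`dpZero_eq`). Thus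
`L*(p_n)/p_n'(0)` is an explicit multiple of `ζ'(-n)/ζ(1-n)`, which the functional equation converts
to `ζ(n+1)/ζ(n)`. The limit follows from `ζ(n) → 1`. Linear combinations use the linearity of `L*`
and the fact that `p_n` has exact degree `n`. -/

namespace QuotZeta

/-! ### The recurrence for the polynomials `p_n` -/

section Recurrence

/-- Leibniz rule for differences: only the first difference of the linear factor survives. At `ν =
0` the truncated `ν - 1` is harmless, its coefficient being `0`. -/
theorem fwdDiff_iter_add_one_mul {R : Type*} [CommRing R] (f : R → R) (ν : ℕ) (y : R) :
    (fwdDiff (1 : R))^[ν] (fun y => (y + 1) * f y) y =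
      (y + 1) * (fwdDiff (1 : R))^[ν] f y + ν * (fwdDiff (1 : R))^[ν - 1] f (y + 1) := by
  induction ν generalizing y with
  | zero => simp
  | succ ν ih =>
    rw [Function.iterate_succ_apply', fwdDiff, ih, ih, Function.iterate_succ_apply', fwdDiff]
    cases ν with
    | zero => simp; ring
    | succ ν =>
      simp only [Nat.add_sub_cancel]
      rw [Function.iterate_succ_apply' _ ν, fwdDiff, fwdDiff]
      push_cast
      ring

theorem diffPow_comp (ν n : ℕ) :
    (diffPow ν n).comp (X + 1) =
      (fwdDiff (1 : ℚ[X]))^[ν] (fun y => (y + 1) ^ n) (X + 1) := by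
  rw [diffPow, fwdDiff_iter_eq_sum_shift, fwdDiff_iter_eq_sum_shift, Polynomial.sum_comp]
  refine Finset.sum_congr rfl fun k _ => ?_
  simp only [zsmul_eq_mul, mul_comp, pow_comp, add_comp, X_comp, one_comp, intCast_comp, nsmul_eq_mul,
    natCast_comp]

theorem diffPow_succ (ν n : ℕ) :
    diffPow ν (n + 1) = (X + 1) * diffPow ν n + (ν : ℚ[X]) * (diffPow (ν - 1) n).comp (X + 1) := by
  rw [diffPow_comp, diffPow, diffPow, ← fwdDiff_iter_add_one_mul]
  simp only [pow_succ']

theorem diffPow_eq_zero {ν n : ℕ} (h : n < ν) : diffPow ν n = 0 := by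
  rw [diffPow, fwdDiff_iter_comp_add (1 : ℚ[X]) (fun y : ℚ[X] => y ^ n) 1,
    fwdDiff_iter_pow_eq_zero_of_lt h]
  rfl

theorem binomPoly_succ (ν : ℕ) :
    ((ν + 1 : ℕ) : ℚ[X]) * binomPoly (ν + 1) = (X + 1) * (binomPoly ν).comp (X + 1) := by
  have h : (descPochhammer ℚ (ν + 1)).comp (X + ((ν + 1 : ℕ) : ℚ[X])) =
      (X + 1) * ((descPochhammer ℚ ν).comp (X + (ν : ℚ[X]))).comp (X + 1) := by
    rw [descPochhammer_succ_right, comp_assoc, mul_comp]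
    simp only [sub_comp, X_comp, natCast_comp, add_comp]
    push_cast
    rw [mul_comm]
    congr 1
    · ring
    · congr 1; ring
  have h2 : ((ν + 1 : ℕ) : ℚ[X]) * C (((ν + 1).factorial : ℚ)⁻¹) = C ((ν.factorial : ℚ)⁻¹) := by
    rw [← C_eq_natCast, ← C_mul]
    congr 1
    rw [Nat.factorial_succ]
    push_cast
    have : (ν.factorial : ℚ) ≠ 0 := by positivity
    field_simp
  rw [binomPoly, ← mul_assoc, h2, h, binomPoly, mul_comp, C_comp]
  ring

/-- The Leibniz rule splits `Δ^ν (x+1)^(n+1)` in two. The first part reproduces `2 p_n`; in the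
second, the factor `ν` is absorbed by `binomPoly_succ` after an index shift, leaving `p_n(X+1)`. -/
theorem p_succ (n : ℕ) :
    p (n + 1) = (X + 1) * (2 * p n - (p n).comp (X + 1)) := by
  have h1 : ∑ ν ∈ Finset.range (n + 2),
      (-1) ^ ν * 2 ^ (n + 1 - ν) * binomPoly ν * diffPow ν n = 2 * p n := by
    rw [Finset.sum_range_succ, diffPow_eq_zero (Nat.lt_succ_self n), mul_zero, add_zero, p,
      Finset.mul_sum]
    refine Finset.sum_congr rfl fun ν hν => ?_
    rw [Nat.succ_sub (Nat.lt_succ_iff.mp (Finset.mem_range.mp hν)), pow_succ]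
    ring
  have h2 : ∑ ν ∈ Finset.range (n + 2),
      (-1) ^ ν * 2 ^ (n + 1 - ν) * binomPoly ν * ((ν : ℚ[X]) * (diffPow (ν - 1) n).comp (X + 1)) =
      -((X + 1) * (p n).comp (X + 1)) := by
    rw [Finset.sum_range_succ', p, Polynomial.sum_comp, Finset.mul_sum, ← Finset.sum_neg_distrib]
    simp only [Nat.cast_zero, zero_mul, mul_zero, add_zero]
    refine Finset.sum_congr rfl fun ν _ => ?_
    have := binomPoly_succ ν
    simp only [mul_comp, pow_comp, neg_comp, one_comp, ofNat_comp, Nat.add_sub_cancel,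
      Nat.add_sub_add_right, pow_succ]
    linear_combination (-(-1) ^ ν * 2 ^ (n - ν) * (diffPow ν n).comp (X + 1)) * this
  have h3 : p (n + 1) = (X + 1) * (2 * p n) + -((X + 1) * (p n).comp (X + 1)) := by
    rw [← h1, ← h2, Finset.mul_sum, ← Finset.sum_add_distrib, p]
    refine Finset.sum_congr rfl fun ν _ => ?_
    rw [diffPow_succ]
    ring
  rw [h3]
  ring

theorem p_zero : p 0 = 1 := by
  simp [p, binomPoly, diffPow]

theorem p_monic_natDegree (n : ℕ) : (p n).Monic ∧ (p n).natDegree = n := by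
  induction n with
  | zero => simp [p_zero]
  | succ n ih =>
    obtain ⟨hm, hd⟩ := ih
    have hX : (X + 1 : ℚ[X]).natDegree = 1 := by simpa using natDegree_X_add_C (1 : ℚ)
    have hXm : (X + 1 : ℚ[X]).Monic := by simpa using monic_X_add_C (1 : ℚ)
    have hcm : ((p n).comp (X + 1)).Monic := hm.comp hXm (by simp [hX])
    have hcd : ((p n).comp (X + 1)).natDegree = n := by rw [natDegree_comp, hd, hX, mul_one]
    have hlt : (p n - (p n).comp (X + 1)).degree < (p n).degree := by
      refine degree_sub_lt_left ?_ hm.ne_zero (hm.leadingCoeff.trans hcm.leadingCoeff.symm)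
      rw [degree_eq_natDegree hm.ne_zero, degree_eq_natDegree hcm.ne_zero, hd, hcd]
    -- The difference `p n - (p n).comp (X + 1)` has lower degree, so the leading term is that of `p
    -- n`.
    have he : 2 * p n - (p n).comp (X + 1) = p n + (p n - (p n).comp (X + 1)) := by ring
    have hm2 : (2 * p n - (p n).comp (X + 1)).Monic := by
      rw [he]; exact hm.add_of_left hlt
    have hd2 : (2 * p n - (p n).comp (X + 1)).natDegree = n := by
      rw [he, natDegree_add_eq_left_of_degree_lt hlt, hd]
    rw [p_succ]
    exact ⟨hXm.mul hm2, by rw [hXm.natDegree_mul hm2, hX, hd2, add_comm]⟩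

end Recurrence

/-! ### Generating functions and the value of `p_n'(0)` -/

section PowerSeries
open scoped PowerSeries
open PowerSeries (evalNegHom exp exp_mul_exp_neg_eq_one derivative_exp)

/-- The power series `2 / (1 + exp (-w))`. -/
noncomputable def logisticSeries : ℚ⟦X⟧ := 2 * (1 + evalNegHom (exp ℚ))⁻¹

/-- The formal logarithm of `logisticSeries`. -/
noncomputable def logLogisticSeries : ℚ⟦X⟧ :=
  PowerSeries.mk fun n => PowerSeries.coeff (n - 1) (1 - PowerSeries.C (1 / 2 : ℚ) * logisticSeries) / n

theorem derivative_evalNegHom (f : ℚ⟦X⟧) :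
    d⁄dX ℚ (evalNegHom f) = -evalNegHom (d⁄dX ℚ f) := by
  ext n
  simp only [evalNegHom, PowerSeries.coeff_derivative, PowerSeries.coeff_rescale, map_neg]
  ring

theorem constantCoeff_evalNegHom (f : ℚ⟦X⟧) :
    PowerSeries.constantCoeff (evalNegHom f) = PowerSeries.constantCoeff f := by
  simp [evalNegHom, ← PowerSeries.coeff_zero_eq_constantCoeff_apply, -PowerSeries.coeff_zero_eq_constantCoeff, PowerSeries.coeff_rescale]

theorem two_powerSeries_ne_zero : (2 : ℚ⟦X⟧) ≠ 0 := by
  intro h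
  have := congrArg PowerSeries.constantCoeff h
  rw [map_ofNat, map_zero] at this
  norm_num at this

theorem logisticSeries_mul : logisticSeries * (1 + evalNegHom (exp ℚ)) = 2 := by
  rw [logisticSeries, mul_assoc, PowerSeries.inv_mul_cancel, mul_one]
  rw [map_add, constantCoeff_evalNegHom]
  simp

theorem one_add_exp_ne_zero : (1 + evalNegHom (exp ℚ)) ≠ 0 := by
  intro h
  have := logisticSeries_mul
  rw [h, mul_zero] at this
  exact two_powerSeries_ne_zero this.symm

theorem constantCoeff_logisticSeries : PowerSeries.constantCoeff logisticSeries = 1 := by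
  have := congrArg PowerSeries.constantCoeff logisticSeries_mul
  rw [map_mul, map_add, constantCoeff_evalNegHom] at this
  simp at this
  have h2 : PowerSeries.constantCoeff (2 : ℚ⟦X⟧) = 2 := map_ofNat _ 2
  linarith

theorem two_mul_derivative_logisticSeries :
    2 * d⁄dX ℚ logisticSeries = logisticSeries * (2 - logisticSeries) := by
  have h := logisticSeries_mul
  have h2 := congrArg (d⁄dX ℚ) h
  have h3 : d⁄dX ℚ (2 : ℚ⟦X⟧) = 0 := by
    rw [← map_ofNat (PowerSeries.C (R := ℚ)) 2, PowerSeries.derivative_C]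
  rw [Derivation.leibniz, map_add, derivative_evalNegHom, derivative_exp, h3, PowerSeries.derivative_one,
    smul_eq_mul, smul_eq_mul] at h2
  refine mul_right_cancel₀ one_add_exp_ne_zero ?_
  linear_combination 2 * h2 + (logisticSeries) * h

theorem evalNegHom_logisticSeries : evalNegHom logisticSeries = 2 - logisticSeries := by
  have h := logisticSeries_mul
  have h2 := congrArg evalNegHom h
  have h4 : evalNegHom (evalNegHom (exp ℚ)) = exp ℚ := by
    ext n; simp [evalNegHom, PowerSeries.coeff_rescale, ← mul_assoc, ← mul_pow]
  rw [map_mul, map_add, h4, map_one, map_ofNat] at h2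
  have h5 := exp_mul_exp_neg_eq_one (A := ℚ)
  refine mul_right_cancel₀ one_add_exp_ne_zero ?_
  linear_combination h + h2 * evalNegHom (exp ℚ) - evalNegHom logisticSeries * h5

/-- This is `G'/G = 1 - G/2` for the formal logarithm, built into its coefficients by termwise
integration; the constant term is `0` because division by `0` returns `0`. -/
theorem two_mul_derivative_logLogisticSeries :
    2 * d⁄dX ℚ logLogisticSeries = 2 - logisticSeries := by
  have h : d⁄dX ℚ logLogisticSeries = 1 - PowerSeries.C (1 / 2 : ℚ) * logisticSeries := by
    ext n
    rw [PowerSeries.coeff_derivative, logLogisticSeries, PowerSeries.coeff_mk, Nat.add_sub_cancel]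
    have : (n : ℚ) + 1 ≠ 0 := by positivity
    push_cast
    field_simp
  have h2 : (2 : ℚ⟦X⟧) * PowerSeries.C (1 / 2 : ℚ) = 1 := by
    have : (2 : ℚ⟦X⟧) = PowerSeries.C (2 : ℚ) := (map_ofNat _ 2).symm
    rw [this, ← map_mul]; norm_num
  rw [h]
  linear_combination (-logisticSeries) * h2

theorem constantCoeff_logLogisticSeries : PowerSeries.constantCoeff logLogisticSeries = 0 := by
  simp [logLogisticSeries, ← PowerSeries.coeff_zero_eq_constantCoeff_apply, -PowerSeries.coeff_zero_eq_constantCoeff]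

theorem logLogisticSeries_sub_evalNegHom :
    logLogisticSeries - evalNegHom logLogisticSeries = PowerSeries.X := by
  refine PowerSeries.derivative.ext ?_ ?_
  · have h := two_mul_derivative_logLogisticSeries
    have h2 := congrArg evalNegHom h
    rw [map_mul, map_sub, map_ofNat, evalNegHom_logisticSeries] at h2
    rw [map_sub, derivative_evalNegHom, PowerSeries.derivative_X]
    refine mul_left_cancel₀ (two_powerSeries_ne_zero) ?_
    linear_combination h + h2
  · rw [map_sub, constantCoeff_evalNegHom]; simp

/-- The logistic equation `2G' = G(2 - G)` makes the coefficients of `G^(x+1)` obey the recurrence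
of `p_succ`. -/
theorem factorial_mul_coeff_pow_logisticSeries (n x : ℕ) :
    2 ^ n * (n.factorial : ℚ) * PowerSeries.coeff n (logisticSeries ^ (x + 1)) = (p n).eval (x : ℚ) := by
  induction n generalizing x with
  | zero => simp [p_zero, constantCoeff_logisticSeries]
  | succ n ih =>
    have hD : 2 * d⁄dX ℚ (logisticSeries ^ (x + 1)) =
        (x + 1 : ℕ) * (2 * logisticSeries ^ (x + 1) - logisticSeries ^ (x + 1 + 1)) := by
      rw [Derivation.leibniz_pow, nsmul_eq_mul, smul_eq_mul, Nat.add_sub_cancel]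
      linear_combination ((x + 1 : ℕ) : ℚ⟦X⟧) * logisticSeries ^ x *
        two_mul_derivative_logisticSeries
    have hc := congrArg (PowerSeries.coeff n) hD
    have e2 : (2 : ℚ⟦X⟧) = PowerSeries.C (2 : ℚ) := (map_ofNat _ 2).symm
    have e3 : ((x + 1 : ℕ) : ℚ⟦X⟧) = PowerSeries.C ((x + 1 : ℕ) : ℚ) := (map_natCast _ _).symm
    rw [e2, e3, PowerSeries.coeff_C_mul, PowerSeries.coeff_C_mul, map_sub, PowerSeries.coeff_C_mul,
      PowerSeries.coeff_derivative] at hc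
    rw [p_succ]
    have i1 := ih x
    have i2 := ih (x + 1)
    simp only [eval_mul, eval_add, eval_X, eval_one, eval_sub, eval_ofNat, eval_comp]
    push_cast at i2 hc
    rw [← i1, ← i2, Nat.factorial_succ]
    push_cast
    linear_combination 2 ^ n * (n.factorial : ℚ) * hc

/-- Formally the `x`-derivative of the previous identity. Only natural exponents occur, so the
differentiated recurrence is checked directly. -/
theorem factorial_mul_coeff_pow_mul_logLogisticSeries (n x : ℕ) :
    2 ^ n * (n.factorial : ℚ) * PowerSeries.coeff n (logisticSeries ^ (x + 1) * logLogisticSeries) =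
      (derivative (p n)).eval (x : ℚ) := by
  induction n generalizing x with
  | zero => simp [p_zero, constantCoeff_logLogisticSeries]
  | succ n ih =>
    have hD : 2 * d⁄dX ℚ (logisticSeries ^ (x + 1) * logLogisticSeries) =
        (2 * logisticSeries ^ (x + 1) - logisticSeries ^ (x + 1 + 1)) +
        (x + 1 : ℕ) * (2 * (logisticSeries ^ (x + 1) * logLogisticSeries) -
          logisticSeries ^ (x + 1 + 1) * logLogisticSeries) := by
      rw [Derivation.leibniz, Derivation.leibniz_pow, nsmul_eq_mul, smul_eq_mul, smul_eq_mul,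
        smul_eq_mul, Nat.add_sub_cancel]
      linear_combination ((x + 1 : ℕ) : ℚ⟦X⟧) * logisticSeries ^ x * logLogisticSeries *
        two_mul_derivative_logisticSeries +
        logisticSeries ^ (x + 1) * two_mul_derivative_logLogisticSeries
    have hc := congrArg (PowerSeries.coeff n) hD
    have e2 : (2 : ℚ⟦X⟧) = PowerSeries.C (2 : ℚ) := (map_ofNat _ 2).symm
    have e3 : ((x + 1 : ℕ) : ℚ⟦X⟧) = PowerSeries.C ((x + 1 : ℕ) : ℚ) := (map_natCast _ _).symm
    rw [e2, e3, map_add, PowerSeries.coeff_C_mul, PowerSeries.coeff_C_mul, map_sub, map_sub,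
      PowerSeries.coeff_C_mul, PowerSeries.coeff_C_mul, PowerSeries.coeff_derivative] at hc
    rw [p_succ]
    have i1 := ih x
    have i2 := ih (x + 1)
    have j1 := factorial_mul_coeff_pow_logisticSeries n x
    have j2 := factorial_mul_coeff_pow_logisticSeries n (x + 1)
    simp only [derivative_mul, derivative_add, derivative_sub, derivative_X, derivative_one,
      derivative_comp, derivative_ofNat, eval_mul, eval_add, eval_X, eval_one, eval_zero, eval_sub,
      eval_ofNat, eval_comp]
    push_cast at i2 j2 hc
    rw [← i1, ← i2, ← j1, ← j2, Nat.factorial_succ]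
    push_cast
    linear_combination 2 ^ n * (n.factorial : ℚ) * hc

theorem dpZero_eq {n : ℕ} (hn : 0 < n) (he : Even n) :
    dpZero n = (n - 1) * (p (n - 1)).eval 0 := by
  obtain ⟨m, rfl⟩ : ∃ m, n = m + 1 := ⟨n - 1, by omega⟩
  have h1 := factorial_mul_coeff_pow_mul_logLogisticSeries (m + 1) 0
  have h2 := factorial_mul_coeff_pow_logisticSeries m 0
  simp only [zero_add, pow_one, Nat.cast_zero] at h1 h2
  -- Under `w ↦ -w`, `G` becomes `2 - G` and `log G` becomes `log G - w`. The even coefficients of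
  -- `G log G` are thereby expressed through those of `log G` and `G`.
  have hsym : logisticSeries * logLogisticSeries + evalNegHom (logisticSeries * logLogisticSeries)
      = 2 * logLogisticSeries - 2 * PowerSeries.X + PowerSeries.X * logisticSeries := by
    rw [map_mul, evalNegHom_logisticSeries]
    linear_combination (logisticSeries - 2) * logLogisticSeries_sub_evalNegHom
  have e2 : (2 : ℚ⟦X⟧) = PowerSeries.C (2 : ℚ) := (map_ofNat _ 2).symm
  have hc := congrArg (PowerSeries.coeff (m + 1)) hsym
  have hX : PowerSeries.coeff (m + 1) (PowerSeries.X : ℚ⟦X⟧) = 0 := by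
    rw [PowerSeries.coeff_X, if_neg]
    rintro h
    rw [h] at he
    exact absurd he (by decide)
  have hneg : PowerSeries.coeff (m + 1) (evalNegHom (logisticSeries * logLogisticSeries)) =
      PowerSeries.coeff (m + 1) (logisticSeries * logLogisticSeries) := by
    rw [evalNegHom, PowerSeries.coeff_rescale, he.neg_one_pow, one_mul]
  rw [map_add, map_add, map_sub, hneg, e2, PowerSeries.coeff_C_mul, PowerSeries.coeff_C_mul, hX,
    PowerSeries.coeff_succ_X_mul] at hc
  have hl := congrArg (PowerSeries.coeff m) two_mul_derivative_logLogisticSeries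
  have h2m : PowerSeries.coeff m (2 : ℚ⟦X⟧) = 0 := by
    rw [e2, PowerSeries.coeff_C, if_neg]
    rintro rfl
    exact absurd he (by decide)
  rw [map_sub, h2m, e2, PowerSeries.coeff_C_mul, PowerSeries.coeff_derivative] at hl
  rw [dpZero, ← h1, Nat.add_sub_cancel, ← h2, Nat.factorial_succ]
  push_cast
  linear_combination 2 ^ m * (m.factorial : ℚ) * ((m + 1) * hc + hl)

end PowerSeries

/-! ### Alternating binomial sums `D_m(s)` -/

section Differences

/-- The alternating binomial sum `∑ (-1)^k binom(m, k) (k + 1)^(-s)`, that is,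
`(-1)^m` times the `m`-th forward difference of `x ↦ x^(-s)` at `1`. -/
noncomputable def altBinomSum (m : ℕ) (s : ℂ) : ℂ :=
  ∑ k ∈ Finset.range (m + 1), (-1) ^ k * (m.choose k : ℂ) * ((k : ℂ) + 1) ^ (-s)

theorem natCast_add_one_mul_cpow (k : ℕ) (s : ℂ) :
    ((k : ℂ) + 1) * ((k : ℂ) + 1) ^ (-(s + 1)) = ((k : ℂ) + 1) ^ (-s) := by
  have h : (k : ℂ) + 1 ≠ 0 := Nat.cast_add_one_ne_zero k
  rw [neg_add, Complex.cpow_add _ _ h, Complex.cpow_neg_one]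
  field_simp

/-- Split off one factor `k + 1 = (m + 1) - (m - k)` and use `(m - k) binom(m,k) = m binom(m-1,k)`.
-/
theorem altBinomSum_eq (m : ℕ) (s : ℂ) :
    altBinomSum m s = (m + 1) * altBinomSum m (s + 1) - m * altBinomSum (m - 1) (s + 1) := by
  cases m with
  | zero =>
    simp [altBinomSum]
  | succ m =>
    have h : altBinomSum m (s + 1) = ∑ k ∈ Finset.range (m + 2),
        (-1) ^ k * (m.choose k : ℂ) * ((k : ℂ) + 1) ^ (-(s + 1)) := by
      rw [Finset.sum_range_succ, Nat.choose_succ_self]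
      simp [altBinomSum]
    rw [Nat.add_sub_cancel, h, altBinomSum, altBinomSum, Finset.mul_sum, Finset.mul_sum,
      ← Finset.sum_sub_distrib]
    refine Finset.sum_congr rfl fun k hk => ?_
    have hk' : k ≤ m + 1 := by simpa [Nat.lt_succ_iff] using hk
    have hc : ((m.choose k : ℂ)) * (m + 1) = ((m + 1).choose k : ℂ) * (m + 1 - k) := by
      have := Nat.choose_mul_succ_eq m k
      have h2 : ((m + 1 - k : ℕ) : ℂ) = m + 1 - k := by push_cast [Nat.cast_sub hk']; ring
      rw [← h2]
      exact_mod_cast this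
    rw [← natCast_add_one_mul_cpow]
    push_cast
    linear_combination (-1) ^ k * ((k : ℂ) + 1) ^ (-(s + 1)) * hc

theorem altBinomSum_at_zero (m : ℕ) : altBinomSum m 0 = if m = 0 then 1 else 0 := by
  have h := add_pow (-1 : ℂ) 1 m
  simp only [one_pow, mul_one, neg_add_cancel] at h
  simp only [altBinomSum, neg_zero, Complex.cpow_zero, mul_one]
  rw [← h, zero_pow_eq]

theorem hasDerivAt_altBinomSum (m : ℕ) (s : ℂ) :
    HasDerivAt (altBinomSum m) (∑ k ∈ Finset.range (m + 1), (-1) ^ k * (m.choose k : ℂ) *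
      (-((k : ℂ) + 1) ^ (-s) * Complex.log ((k : ℂ) + 1))) s := by
  unfold altBinomSum
  refine HasDerivAt.fun_sum fun k _ => HasDerivAt.const_mul _ ?_
  have h := (hasDerivAt_neg s).const_cpow (c := (k : ℂ) + 1)
    (Or.inl (Nat.cast_add_one_ne_zero k))
  exact h.congr_deriv (by ring)

theorem differentiable_altBinomSum (m : ℕ) : Differentiable ℂ (altBinomSum m) :=
  fun s => (hasDerivAt_altBinomSum m s).differentiableAt

theorem deriv_altBinomSum_zero (m : ℕ) : deriv (altBinomSum m) 0 = 2 ^ m * (a m : ℂ) := by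
  rw [(hasDerivAt_altBinomSum m 0).deriv, a, fwdDiff_iter_eq_sum_shift]
  have hlog (k : ℕ) : Complex.log ((k : ℂ) + 1) = ((Real.log (1 + k) : ℝ) : ℂ) := by
    rw [Complex.ofReal_log (by positivity)]
    push_cast
    rw [add_comm]
  simp only [hlog, neg_zero, Complex.cpow_zero]
  push_cast
  rw [← mul_assoc, mul_div_cancel₀ _ (pow_ne_zero m two_ne_zero), Finset.mul_sum]
  refine Finset.sum_congr rfl fun k hk => ?_
  have hk' : k ≤ m := Nat.lt_succ_iff.mp (Finset.mem_range.mp hk)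
  simp only [nsmul_eq_mul, mul_one, zsmul_eq_mul]
  push_cast
  have hs : (-1 : ℂ) ^ (m + 1) * (-1) ^ (m - k) = - (-1) ^ k := by
    rw [← pow_add, show m + 1 + (m - k) = 2 * (m - k) + k + 1 by omega, pow_succ, pow_add, pow_mul]
    simp
  linear_combination (-(m.choose k : ℂ) * ((Real.log (1 + k) : ℝ) : ℂ)) * hs

end Differences

/-! ### Polynomial growth of `D_m` and absolute convergence -/

section Bounds
open MeasureTheory Set

theorem integrableOn_cpow_mul_exp {s : ℂ} (hs : 0 < s.re) {r : ℝ} (hr : 0 < r) :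
    IntegrableOn (fun t : ℝ => (t : ℂ) ^ (s - 1) * Complex.exp (-(r * t))) (Ioi 0) := by
  -- A non-integrable function has integral `0` by convention, so a nonzero integral proves
  -- integrability.
  refine not_imp_comm.1 integral_undef ?_
  rw [Complex.integral_cpow_mul_exp_neg_mul_Ioi hs hr]
  refine mul_ne_zero ?_ (Complex.Gamma_ne_zero_of_re_pos hs)
  rw [Complex.cpow_ne_zero_iff_of_exponent_ne_zero (by rintro rfl; simp at hs)]
  exact one_div_ne_zero (by exact_mod_cast hr.ne')

theorem altBinomSum_mul_Gamma (m : ℕ) {s : ℂ} (hs : 0 < s.re) :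
    altBinomSum m s * Complex.Gamma s =
      ∫ t : ℝ in Ioi 0, (t : ℂ) ^ (s - 1) * Complex.exp (-t) * (1 - Complex.exp (-t)) ^ m := by
  have hk (k : ℕ) : (-1) ^ k * (m.choose k : ℂ) * ((k : ℂ) + 1) ^ (-s) * Complex.Gamma s =
      ∫ t : ℝ in Ioi 0, (-1) ^ k * (m.choose k : ℂ) *
        ((t : ℂ) ^ (s - 1) * Complex.exp (-(((k + 1 : ℝ) : ℝ) * t))) := by
    rw [integral_const_mul, Complex.integral_cpow_mul_exp_neg_mul_Ioi hs (by positivity)]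
    push_cast
    rw [one_div, Complex.inv_cpow, Complex.cpow_neg, mul_assoc]
    have : ((k : ℂ) + 1).arg = 0 := by
      have := Complex.natCast_arg (n := k + 1)
      exact_mod_cast this
    rw [this]
    exact Real.pi_ne_zero.symm
  rw [altBinomSum, Finset.sum_mul, Finset.sum_congr rfl fun k _ => hk k, ← integral_finsetSum]
  · refine setIntegral_congr_fun measurableSet_Ioi fun t _ => ?_
    rw [sub_eq_neg_add (1 : ℂ) (Complex.exp _), add_pow, Finset.mul_sum]
    refine Finset.sum_congr rfl fun k _ => ?_
    have he : Complex.exp (-(((k + 1 : ℝ) : ℝ) * t)) =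
        Complex.exp (-t) * Complex.exp (-t) ^ k := by
      rw [← Complex.exp_nat_mul, ← Complex.exp_add]
      congr 1
      push_cast
      ring
    rw [he, neg_pow]
    simp only [one_pow]
    ring
  · intro k _
    exact (integrableOn_cpow_mul_exp hs (by positivity)).const_mul _

/-- In the Gamma-type integral the factor `(1 - e^(-t))^m` lies in `[0, 1]`, so the bound is uniform
in `m`. -/
theorem norm_altBinomSum_mul_Gamma_le (m : ℕ) {s : ℂ} (hs : 0 < s.re) :
    ‖altBinomSum m s * Complex.Gamma s‖ ≤ Real.Gamma s.re := by
  rw [altBinomSum_mul_Gamma m hs, Real.Gamma_eq_integral hs]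
  refine norm_integral_le_of_norm_le (Real.GammaIntegral_convergent hs) ?_
  refine (ae_restrict_iff' measurableSet_Ioi).mpr (Eventually.of_forall fun t (ht : 0 < t) => ?_)
  have h1 : ‖(1 - Complex.exp (-(t : ℂ))) ^ m‖ ≤ 1 := by
    rw [norm_pow]
    refine pow_le_one₀ (norm_nonneg _) ?_
    have : (1 - Complex.exp (-(t : ℂ))) = ((1 - Real.exp (-t) : ℝ) : ℂ) := by push_cast; rfl
    rw [this, Complex.norm_real, Real.norm_eq_abs, abs_le]
    have := Real.exp_pos (-t)
    have : Real.exp (-t) ≤ 1 := Real.exp_le_one_iff.mpr (by linarith)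
    constructor <;> linarith
  have h2 : ‖(t : ℂ) ^ (s - 1) * Complex.exp (-(t : ℂ))‖ = Real.exp (-t) * t ^ (s.re - 1) := by
    rw [norm_mul, Complex.norm_cpow_eq_rpow_re_of_pos ht, Complex.norm_exp]
    simp [mul_comm]
  rw [norm_mul, h2]
  exact mul_le_of_le_one_right (by positivity) h1

/-- For `Re s ≥ 1` the Gamma bound and compactness give a constant. Each unit step to the left costs
a factor `2(m + 1)` by `altBinomSum_eq`. -/
theorem exists_norm_altBinomSum_le_of_re_ge (M : ℕ) (R : ℝ) :
    ∃ C : ℝ, 0 ≤ C ∧ ∀ (m : ℕ) (s : ℂ), ‖s‖ ≤ R → 1 - M ≤ s.re →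
      ‖altBinomSum m s‖ ≤ C * ((m : ℝ) + 1) ^ M := by
  induction M generalizing R with
  | zero =>
    have hK : IsCompact (Metric.closedBall (0 : ℂ) R ∩ {s : ℂ | 1 ≤ s.re}) :=
      (isCompact_closedBall 0 R).inter_right (isClosed_le continuous_const Complex.continuous_re)
    have hc : ContinuousOn (fun s : ℂ => Real.Gamma s.re * ‖(Complex.Gamma s)⁻¹‖)
        (Metric.closedBall (0 : ℂ) R ∩ {s : ℂ | 1 ≤ s.re}) := by
      intro s hs
      have hs1 : 1 ≤ s.re := hs.2
      have hg : ContinuousAt Real.Gamma s.re :=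
        (Real.differentiableAt_Gamma fun n h => by
          have : (0 : ℝ) ≤ n := n.cast_nonneg
          linarith).continuousAt
      exact ((hg.comp Complex.continuous_re.continuousAt).mul
        (Complex.differentiable_one_div_Gamma s).continuousAt.norm).continuousWithinAt
    obtain ⟨C, hC⟩ := hK.exists_bound_of_continuousOn hc
    refine ⟨max C 0, le_max_right _ _, fun m s hR hs => ?_⟩
    simp only [Nat.cast_zero, sub_zero] at hs
    have hs0 : 0 < s.re := by linarith
    have h1 := hC s ⟨by simpa using hR, hs⟩
    have h2 := norm_altBinomSum_mul_Gamma_le m hs0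
    have hG := Complex.Gamma_ne_zero_of_re_pos hs0
    rw [pow_zero, mul_one]
    refine le_trans ?_ (le_trans ((le_abs_self _).trans h1) (le_max_left _ _))
    calc ‖altBinomSum m s‖ = ‖altBinomSum m s * Complex.Gamma s‖ * ‖(Complex.Gamma s)⁻¹‖ := by
          rw [← norm_mul, mul_inv_cancel_right₀ hG]
      _ ≤ _ := by gcongr
  | succ M ih =>
    obtain ⟨C, hC0, hC⟩ := ih (R + 1)
    refine ⟨2 * C, by positivity, fun m s hR hs => ?_⟩
    have hR' : ‖s + 1‖ ≤ R + 1 := (norm_add_le _ _).trans (by simpa using hR)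
    have hs' : 1 - (M : ℝ) ≤ (s + 1).re := by
      push_cast at hs
      simp only [Complex.add_re, Complex.one_re]
      linarith
    have h1 := hC m (s + 1) hR' hs'
    have h2 := hC (m - 1) (s + 1) hR' hs'
    have h3 : C * (((m - 1 : ℕ) : ℝ) + 1) ^ M ≤ C * ((m : ℝ) + 1) ^ M := by
      gcongr
      exact Nat.sub_le _ _
    rw [altBinomSum_eq]
    refine (norm_sub_le _ _).trans ?_
    rw [norm_mul, norm_mul, Complex.norm_natCast]
    have h4 : ‖(m : ℂ) + 1‖ = (m : ℝ) + 1 := by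
      have := Complex.norm_natCast (m + 1)
      push_cast at this
      exact this
    rw [h4]
    have hm : (0 : ℝ) ≤ m := m.cast_nonneg
    calc ((m : ℝ) + 1) * ‖altBinomSum m (s + 1)‖ + m * ‖altBinomSum (m - 1) (s + 1)‖
        ≤ (m + 1) * (C * ((m : ℝ) + 1) ^ M) + (m + 1) * (C * ((m : ℝ) + 1) ^ M) := by
          gcongr
          · linarith
          · exact h2.trans h3
      _ = 2 * C * ((m : ℝ) + 1) ^ (M + 1) := by ring

/-- On every disc the alternating binomial sums grow at most polynomially in `m`. -/
theorem exists_norm_altBinomSum_le (R : ℝ) :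
    ∃ (M : ℕ) (C : ℝ), 0 ≤ C ∧ ∀ (m : ℕ) (s : ℂ), ‖s‖ ≤ R →
      ‖altBinomSum m s‖ ≤ C * ((m : ℝ) + 1) ^ M := by
  obtain ⟨M, hM⟩ := exists_nat_ge (R + 1)
  obtain ⟨C, hC0, hC⟩ := exists_norm_altBinomSum_le_of_re_ge M R
  refine ⟨M, C, hC0, fun m s hs => hC m s hs ?_⟩
  have := (abs_le.mp ((Complex.abs_re_le_norm s).trans hs)).1
  linarith

theorem summable_half_pow_mul_eval (f : ℂ[X]) (M : ℕ) :
    Summable fun m : ℕ => (1 / 2 : ℝ) ^ m * ‖f.eval (m : ℂ)‖ * ((m : ℝ) + 1) ^ M := by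
  have hmono (N : ℕ) : Summable fun m : ℕ => (1 / 2 : ℝ) ^ m * ((m : ℝ) + 1) ^ N := by
    have h := summable_pow_mul_geometric_of_norm_lt_one (R := ℝ) N (r := 1 / 2) (by norm_num)
    have h2 := ((summable_nat_add_iff 1).mpr h).mul_left 2
    refine h2.congr fun m => ?_
    push_cast
    rw [pow_succ]
    ring
  induction f using Polynomial.induction_on' with
  | add f g hf hg =>
    refine Summable.of_nonneg_of_le (fun m => by positivity) (fun m => ?_) (hf.add hg)
    rw [eval_add]
    calc _ ≤ (1 / 2 : ℝ) ^ m * (‖f.eval (m : ℂ)‖ + ‖g.eval (m : ℂ)‖) * ((m : ℝ) + 1) ^ M := by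
          gcongr
          exact norm_add_le _ _
      _ = _ := by ring
  | monomial n c =>
    refine Summable.of_nonneg_of_le (fun m => by positivity) (fun m => ?_)
      ((hmono (n + M)).mul_left ‖c‖)
    rw [eval_monomial, norm_mul, norm_pow, Complex.norm_natCast]
    calc _ ≤ (1 / 2 : ℝ) ^ m * (‖c‖ * ((m : ℝ) + 1) ^ n) * ((m : ℝ) + 1) ^ M := by
          gcongr
          linarith
      _ = _ := by ring

/-- Cauchy's estimate on the unit circle. -/
theorem exists_norm_deriv_altBinomSum_zero_le :
    ∃ (M : ℕ) (C : ℝ), 0 ≤ C ∧ ∀ m : ℕ,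
      ‖deriv (altBinomSum m) 0‖ ≤ C * ((m : ℝ) + 1) ^ M := by
  obtain ⟨M, C, hC0, hC⟩ := exists_norm_altBinomSum_le 1
  refine ⟨M, C, hC0, fun m => ?_⟩
  have := Complex.norm_deriv_le_of_forall_mem_sphere_norm_le (c := (0 : ℂ)) (R := 1)
    (C := C * ((m : ℝ) + 1) ^ M) one_pos
    (differentiable_altBinomSum m).diffContOnCl
    (fun z hz => hC m z (by simpa using (mem_sphere_zero_iff_norm.mp hz).le))
  simpa using this

theorem summable_norm_a_mul_eval (f : ℂ[X]) :
    Summable fun n : ℕ => ‖(a n : ℂ) * f.eval (n : ℂ)‖ := by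
  obtain ⟨M, C, hC0, hC⟩ := exists_norm_deriv_altBinomSum_zero_le
  refine Summable.of_nonneg_of_le (fun n => norm_nonneg _) (fun n => ?_)
    ((summable_half_pow_mul_eval f M).mul_left C)
  have h : (a n : ℂ) = (1 / 2) ^ n * deriv (altBinomSum n) 0 := by
    rw [deriv_altBinomSum_zero, ← mul_assoc, ← mul_pow]
    norm_num
  rw [h, norm_mul, norm_mul, norm_pow]
  have h2 : ‖(1 / 2 : ℂ)‖ = 1 / 2 := by norm_num
  rw [h2]
  calc _ ≤ (1 / 2 : ℝ) ^ n * (C * ((n : ℝ) + 1) ^ M) * ‖f.eval (n : ℂ)‖ := by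
        gcongr
        exact hC n
    _ = _ := by ring

theorem summable_norm_a_succ_mul_eval (f : ℂ[X]) :
    Summable fun n : ℕ => ‖(a (n + 1) : ℂ) * f.eval ((n + 1 : ℕ) : ℂ)‖ :=
  (summable_nat_add_iff 1).mpr (summable_norm_a_mul_eval f)

end Bounds

/-! ### The entire function `B_f` and its relation to `ζ` -/

section BinomTransform
open Set

/-- The entire function `s ↦ ∑ 2^(-m) f(m) D_m(s)`, where `D_m` is `altBinomSum m`. -/
noncomputable def binomTransform (f : ℂ[X]) (s : ℂ) : ℂ :=
  ∑' m : ℕ, (1 / 2 : ℂ) ^ m * f.eval (m : ℂ) * altBinomSum m s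

theorem exists_summable_bound_binomTransform (f : ℂ[X]) (R : ℝ) :
    ∃ u : ℕ → ℝ, Summable u ∧ ∀ (m : ℕ) (s : ℂ), s ∈ Metric.ball (0 : ℂ) R →
      ‖(1 / 2 : ℂ) ^ m * f.eval (m : ℂ) * altBinomSum m s‖ ≤ u m := by
  obtain ⟨M, C, hC0, hC⟩ := exists_norm_altBinomSum_le R
  refine ⟨_, (summable_half_pow_mul_eval f M).mul_left C, fun m s hs => ?_⟩
  have h2 : ‖(1 / 2 : ℂ)‖ = 1 / 2 := by norm_num
  rw [norm_mul, norm_mul, norm_pow, h2]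
  calc _ ≤ (1 / 2 : ℝ) ^ m * ‖f.eval (m : ℂ)‖ * (C * ((m : ℝ) + 1) ^ M) := by
        gcongr
        exact hC m s (by simpa using (mem_ball_zero_iff.mp hs).le)
    _ = _ := by ring

theorem summable_binomTransform (f : ℂ[X]) (s : ℂ) :
    Summable fun m : ℕ => (1 / 2 : ℂ) ^ m * f.eval (m : ℂ) * altBinomSum m s := by
  obtain ⟨u, hu, h⟩ := exists_summable_bound_binomTransform f (‖s‖ + 1)
  exact Summable.of_norm_bounded hu fun m => h m s (by simp)

theorem differentiable_binomTransform (f : ℂ[X]) : Differentiable ℂ (binomTransform f) := by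
  intro s
  obtain ⟨u, hu, h⟩ := exists_summable_bound_binomTransform f (‖s‖ + 1)
  have hd := Complex.differentiableOn_tsum_of_summable_norm hu
    (fun m => ((differentiable_altBinomSum m).const_mul
      ((1 / 2 : ℂ) ^ m * f.eval (m : ℂ))).differentiableOn) Metric.isOpen_ball h
  exact hd.differentiableAt (Metric.isOpen_ball.mem_nhds (by simp))

theorem deriv_binomTransform_zero (f : ℂ[X]) : deriv (binomTransform f) 0 = LStar f := by
  obtain ⟨u, hu, h⟩ := exists_summable_bound_binomTransform f 1
  have hd := Complex.hasSum_deriv_of_summable_norm (z := 0) hu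
    (fun m => ((differentiable_altBinomSum m).const_mul
      ((1 / 2 : ℂ) ^ m * f.eval (m : ℂ))).differentiableOn) Metric.isOpen_ball h (by simp)
  have ht (m : ℕ) : deriv (fun s => (1 / 2 : ℂ) ^ m * f.eval (m : ℂ) * altBinomSum m s) 0 =
      (a m : ℂ) * f.eval (m : ℂ) := by
    rw [deriv_const_mul _ (differentiable_altBinomSum m 0), deriv_altBinomSum_zero]
    have : (1 / 2 : ℂ) ^ m * 2 ^ m = 1 := by rw [← mul_pow]; norm_num
    linear_combination (f.eval (m : ℂ)) * (a m : ℂ) * this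
  simp only [ht] at hd
  have h0 : a 0 = 0 := by simp [a]
  have := hd.tsum_eq
  rw [hd.summable.tsum_eq_zero_add, h0] at this
  simp only [Complex.ofReal_zero, zero_mul, zero_add] at this
  exact this.symm

theorem binomTransform_at_zero (f : ℂ[X]) : binomTransform f 0 = f.eval 0 := by
  rw [binomTransform, tsum_eq_single 0]
  · simp [altBinomSum_at_zero]
  · intro m hm
    simp [altBinomSum_at_zero, hm]

/-- Summation by parts. -/
theorem binomTransform_shift (f : ℂ[X]) (s : ℂ) :
    binomTransform ((X + 1) * (2 * f - f.comp (X + 1))) s = 2 * binomTransform f (s - 1) := by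
  have hu := summable_binomTransform ((X + 1) * f) s
  have hv := (summable_binomTransform ((X + 1) * f.comp (X + 1)) s).mul_left (1 / 2)
  set u : ℕ → ℂ := fun m => (1 / 2 : ℂ) ^ m * ((X + 1) * f).eval (m : ℂ) * altBinomSum m s with hu'
  set v : ℕ → ℂ := fun m => (1 / 2 : ℂ) ^ m * f.eval (m : ℂ) * (m * altBinomSum (m - 1) s) with hv'
  have hv1 : (fun m => v (m + 1)) = fun m : ℕ => 1 / 2 * ((1 / 2 : ℂ) ^ m *
      ((X + 1) * f.comp (X + 1)).eval (m : ℂ) * altBinomSum m s) := by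
    funext m
    simp only [hv', eval_mul, eval_add, eval_X, eval_one, eval_comp, Nat.add_sub_cancel]
    push_cast
    ring
  have hvs1 : Summable fun m => v (m + 1) := hv1 ▸ hv
  have hvs : Summable v := (summable_nat_add_iff 1).mp hvs1
  have hv0 : v 0 = 0 := by simp [hv']
  -- Since `v 0 = 0`, shifting the index leaves the sum unchanged; this is the whole summation by
  -- parts.
  have hsum := hvs.tsum_eq_zero_add
  rw [hv0, zero_add] at hsum
  have e1 : binomTransform ((X + 1) * (2 * f - f.comp (X + 1))) s = ∑' m, (2 * u m - 2 * v (m + 1)) := by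
    refine tsum_congr fun m => ?_
    simp only [hu', hv', eval_mul, eval_add, eval_X, eval_one, eval_comp, eval_sub, eval_ofNat,
      Nat.add_sub_cancel]
    push_cast
    ring
  have e2 : binomTransform f (s - 1) = ∑' m, (u m - v m) := by
    refine tsum_congr fun m => ?_
    rw [altBinomSum_eq m (s - 1)]
    simp only [hu', hv', eval_mul, eval_add, eval_X, eval_one, sub_add_cancel]
    ring
  rw [e1, e2, (hu.mul_left 2).tsum_sub (hvs1.mul_left 2), hu.tsum_sub hvs, tsum_mul_left,
    tsum_mul_left, ← hsum]
  ring

/-- The polynomial `p n` over `ℂ`. -/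
noncomputable def pComplex (n : ℕ) : ℂ[X] := (p n).map (algebraMap ℚ ℂ)

theorem pComplex_succ (n : ℕ) :
    pComplex (n + 1) = (X + 1) * (2 * pComplex n - (pComplex n).comp (X + 1)) := by
  simp [pComplex, p_succ, Polynomial.map_comp]

theorem binomTransform_pComplex (n : ℕ) (s : ℂ) :
    binomTransform (pComplex n) s = 2 ^ n * binomTransform 1 (s - n) := by
  induction n generalizing s with
  | zero => simp [pComplex, p_zero]
  | succ n ih =>
    rw [pComplex_succ, binomTransform_shift, ih, pow_succ]
    push_cast
    rw [show s - 1 - (n : ℂ) = s - (n + 1) by ring]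
    ring

theorem hasSum_choose_mul_half_pow (k : ℕ) :
    HasSum (fun m : ℕ => (m.choose k : ℝ) * (1 / 2) ^ m) 2 := by
  have h := (hasSum_choose_mul_geometric_of_norm_lt_one (𝕜 := ℝ) k (r := 1 / 2)
    (by norm_num)).mul_right ((1 / 2) ^ k)
  rw [← hasSum_nat_add_iff' k]
  have h0 : ∑ i ∈ Finset.range k, (i.choose k : ℝ) * (1 / 2) ^ i = 0 :=
    Finset.sum_eq_zero fun i hi => by
      rw [Nat.choose_eq_zero_of_lt (Finset.mem_range.mp hi)]
      simp
  rw [h0, sub_zero]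
  have h2 : (1 : ℝ) / (1 - 1 / 2) ^ (k + 1) * (1 / 2) ^ k = 2 := by
    rw [pow_succ]
    have : (1 / 2 : ℝ) ^ k ≠ 0 := by positivity
    norm_num
  rw [h2] at h
  refine h.congr_fun fun n => ?_
  rw [pow_add, mul_assoc]

theorem summable_natCast_add_one_cpow_neg {s : ℂ} (hs : 1 < s.re) :
    Summable fun k : ℕ => ((k : ℂ) + 1) ^ (-s) := by
  have h := (summable_nat_add_iff 1).mpr (Complex.summable_one_div_nat_cpow.mpr hs)
  refine h.congr fun k => ?_
  rw [Complex.cpow_neg]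
  push_cast
  rw [one_div]

theorem tsum_alternating_cpow {s : ℂ} (hs : 1 < s.re) :
    ∑' k : ℕ, (-1) ^ k * ((k : ℂ) + 1) ^ (-s) = (1 - 2 ^ (1 - s)) * riemannZeta s := by
  have hS := summable_natCast_add_one_cpow_neg hs
  have hz : riemannZeta s = ∑' k : ℕ, ((k : ℂ) + 1) ^ (-s) := by
    rw [zeta_eq_tsum_one_div_nat_add_one_cpow hs]
    simp only [Complex.cpow_neg, one_div]
  set g : ℕ → ℂ := fun k => ((k : ℂ) + 1) ^ (-s) with hg
  have he : Summable fun k => g (2 * k) :=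
    hS.comp_injective (mul_right_injective₀ (two_ne_zero (α := ℕ)))
  -- Odd indices carry the even integers `2(k + 1)`, because `g k` involves `k + 1`.
  have hodd (k : ℕ) : g (2 * k + 1) = 2 ^ (-s) * g k := by
    have := Complex.natCast_mul_natCast_cpow 2 (k + 1) (-s)
    simp only [hg]
    push_cast at this ⊢
    rw [← this]
    congr 1
    ring
  have ho : Summable fun k => g (2 * k + 1) := by
    simp only [hodd]
    exact hS.mul_left _
  have hO : ∑' k, g (2 * k + 1) = 2 ^ (-s) * riemannZeta s := by
    simp only [hodd]
    rw [tsum_mul_left, hz]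
  have h1 : ∑' k, g (2 * k) + ∑' k, g (2 * k + 1) = riemannZeta s := by
    rw [tsum_even_add_odd he ho, hz]
  have hge (k : ℕ) : (-1 : ℂ) ^ (2 * k) * g (2 * k) = g (2 * k) := by
    rw [pow_mul, neg_one_sq, one_pow, one_mul]
  have hgo (k : ℕ) : (-1 : ℂ) ^ (2 * k + 1) * g (2 * k + 1) = -g (2 * k + 1) := by
    rw [pow_succ, pow_mul, neg_one_sq, one_pow, one_mul, neg_one_mul]
  have h2 : ∑' k, g (2 * k) + -∑' k, g (2 * k + 1) = ∑' k : ℕ, (-1) ^ k * g k := by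
    rw [← tsum_even_add_odd (f := fun k : ℕ => (-1) ^ k * g k)
      (by simpa only [hge] using he) (by simpa only [hgo] using ho.neg), ← tsum_neg]
    simp only [hge, hgo]
  have h5 : (2 : ℂ) ^ (1 - s) = 2 * 2 ^ (-s) := by
    rw [sub_eq_add_neg, Complex.cpow_add _ _ two_ne_zero, Complex.cpow_one]
  rw [← h2, h5]
  linear_combination h1 - 2 * hO

/-- For `Re s > 1` the double series converges absolutely. Summing over `m` first gives `∑
binom(m,k) 2^(-m) = 2` for every `k`, leaving the alternating zeta series. -/
theorem binomTransform_one_of_one_lt_re {s : ℂ} (hs : 1 < s.re) :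
    binomTransform 1 s = 2 * (1 - 2 ^ (1 - s)) * riemannZeta s := by
  set F : ℕ → ℕ → ℂ := fun k m =>
    (-1) ^ k * ((k : ℂ) + 1) ^ (-s) * ((m.choose k : ℂ) * (1 / 2) ^ m) with hF
  have hnorm (k m : ℕ) : ‖F k m‖ =
      ‖((k : ℂ) + 1) ^ (-s)‖ * ((m.choose k : ℝ) * (1 / 2) ^ m) := by
    simp [hF]
  have hsum : Summable (Function.uncurry F) := by
    refine Summable.of_norm ?_
    rw [summable_prod_of_nonneg fun _ => norm_nonneg _]
    have hk (k : ℕ) : HasSum (fun m => ‖F k m‖) (‖((k : ℂ) + 1) ^ (-s)‖ * 2) := by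
      simp only [hnorm]
      exact (hasSum_choose_mul_half_pow k).mul_left _
    refine ⟨fun k => (hk k).summable, ?_⟩
    refine ((summable_natCast_add_one_cpow_neg hs).norm.mul_right 2).congr fun k => ?_
    exact (hk k).tsum_eq.symm
  have h1 : binomTransform 1 s = ∑' m, ∑' k, F k m := by
    refine tsum_congr fun m => ?_
    rw [tsum_eq_sum (s := Finset.range (m + 1)), altBinomSum, eval_one, mul_one, Finset.mul_sum]
    · refine Finset.sum_congr rfl fun k _ => ?_
      simp only [hF]
      ring
    · intro k hk
      rw [Finset.mem_range, not_lt] at hk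
      simp [hF, Nat.choose_eq_zero_of_lt hk]
  have hC (k : ℕ) : ∑' m : ℕ, (m.choose k : ℂ) * (1 / 2) ^ m = 2 := by
    have h := (hasSum_choose_mul_half_pow k).tsum_eq
    have h2 := congrArg (fun x : ℝ => (x : ℂ)) h
    simp only [Complex.ofReal_tsum] at h2
    push_cast at h2
    exact h2
  rw [h1, Summable.tsum_comm hsum]
  simp only [hF, tsum_mul_left, hC, tsum_mul_right]
  rw [tsum_alternating_cpow hs]
  ring

/-- Identity theorem on the connected set `ℂ \ {1}`, starting from a neighbourhood of `2`. -/
theorem binomTransform_one {s : ℂ} (hs : s ≠ 1) :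
    binomTransform 1 s = 2 * (1 - 2 ^ (1 - s)) * riemannZeta s := by
  have h1 : AnalyticOnNhd ℂ (binomTransform 1) {1}ᶜ :=
    (differentiable_binomTransform 1).differentiableOn.analyticOnNhd isOpen_compl_singleton
  have h2 : AnalyticOnNhd ℂ (fun s => 2 * (1 - 2 ^ (1 - s)) * riemannZeta s) {1}ᶜ := by
    refine DifferentiableOn.analyticOnNhd (fun z hz => ?_) isOpen_compl_singleton
    have hd : DifferentiableAt ℂ (fun s : ℂ => (2 : ℂ) ^ (1 - s)) z :=
      (differentiableAt_id.const_sub 1).const_cpow (Or.inl two_ne_zero)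
    exact (((hd.const_sub 1).const_mul 2).mul (differentiableAt_riemannZeta hz)).differentiableWithinAt
  have h3 := h1.eqOn_of_preconnected_of_eventuallyEq h2
    (isConnected_compl_singleton_of_one_lt_rank (by simp) 1).isPreconnected
    (z₀ := 2) (by simp) (by
      have ho : IsOpen {s : ℂ | 1 < s.re} := isOpen_lt continuous_const Complex.continuous_re
      filter_upwards [ho.mem_nhds (show (2 : ℂ) ∈ {s : ℂ | 1 < s.re} by simp)] with s hs
      exact binomTransform_one_of_one_lt_re hs)
  exact h3 hs

end BinomTransform

/-! ### Values of `ζ` and `ζ'` at nonpositive integers -/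

section SpecialValues

theorem eval_zero_p (n : ℕ) :
    (((p n).eval 0 : ℚ) : ℂ) = 2 ^ (n + 1) * (1 - 2 ^ (n + 1)) * riemannZeta (-n) := by
  have h1 : (((p n).eval 0 : ℚ) : ℂ) = (pComplex n).eval 0 := by
    rw [pComplex, ← map_zero (algebraMap ℚ ℂ), eval_map_apply]
    simp
  have hn : (0 - (n : ℂ)) ≠ 1 := by
    intro h
    have := congrArg Complex.re h
    simp at this
    have h0 : (0 : ℝ) ≤ n := n.cast_nonneg
    linarith
  rw [h1, ← binomTransform_at_zero, binomTransform_pComplex, binomTransform_one hn,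
    zero_sub, sub_neg_eq_add]
  have : (2 : ℂ) ^ (1 + (n : ℂ)) = 2 ^ (n + 1) := by
    rw [add_comm]; exact_mod_cast Complex.cpow_natCast 2 (n + 1)
  rw [this, pow_succ]
  ring

/-- The product rule loses the term containing `ζ(-n)`, so only `ζ'(-n)` remains. -/
theorem LStarRat_p {n : ℕ} (hz : riemannZeta (-n) = 0) :
    LStarRat (p n) = 2 ^ (n + 1) * (1 - 2 ^ (n + 1)) * deriv riemannZeta (-n) := by
  have hn : (-(n : ℂ)) ≠ 1 := by
    intro h
    have := congrArg Complex.re h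
    simp at this
    have h0 : (0 : ℝ) ≤ n := n.cast_nonneg
    linarith
  have h1 : HasDerivAt (fun s => 2 * (1 - (2 : ℂ) ^ (1 - s)) * riemannZeta s)
      (2 * (1 - 2 ^ (n + 1)) * deriv riemannZeta (-n)) (-n) := by
    have hd : DifferentiableAt ℂ (fun s : ℂ => 2 * (1 - (2 : ℂ) ^ (1 - s))) (-n) :=
      (((differentiableAt_id.const_sub 1).const_cpow (Or.inl two_ne_zero)).const_sub 1).const_mul 2
    have := hd.hasDerivAt.mul (differentiableAt_riemannZeta hn).hasDerivAt
    rw [hz, mul_zero, zero_add, sub_neg_eq_add] at this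
    have e : (2 : ℂ) ^ (1 + (n : ℂ)) = 2 ^ (n + 1) := by
      rw [add_comm]; exact_mod_cast Complex.cpow_natCast 2 (n + 1)
    rwa [e] at this
  have h2 : HasDerivAt (binomTransform 1) (2 * (1 - 2 ^ (n + 1)) * deriv riemannZeta (-n)) (-n) := by
    refine h1.congr_of_eventuallyEq ?_
    filter_upwards [isOpen_compl_singleton.mem_nhds (show -(n : ℂ) ∈ ({1}ᶜ : Set ℂ) from hn)]
      with s hs using binomTransform_one hs
  have h3 : HasDerivAt (fun s : ℂ => 2 ^ n * binomTransform 1 (s - n))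
      (2 ^ n * (2 * (1 - 2 ^ (n + 1)) * deriv riemannZeta (-n))) 0 := by
    refine HasDerivAt.const_mul _ ?_
    rw [← zero_sub (n : ℂ)] at h2
    rw [← zero_sub]
    exact h2.comp_sub_const 0 (n : ℂ)
  have h4 : binomTransform (pComplex n) = fun s : ℂ => 2 ^ n * binomTransform 1 (s - n) :=
    funext (binomTransform_pComplex n)
  rw [LStarRat, ← pComplex, ← deriv_binomTransform_zero, h4, h3.deriv, pow_succ]
  ring

theorem riemannZeta_one_sub_even {m : ℕ} (hm : 0 < m) :
    riemannZeta (1 - (2 * m : ℕ)) = 2 * (2 * Real.pi) ^ (-((2 * m : ℕ) : ℂ)) *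
      ((2 * m - 1).factorial : ℂ) * (-1) ^ m * riemannZeta (2 * m : ℕ) := by
  have hne (k : ℕ) : ((2 * m : ℕ) : ℂ) ≠ -k := by
    intro h
    have h2 : ((2 * m + k : ℕ) : ℂ) = 0 := by rw [Nat.cast_add, h]; ring
    rw [Nat.cast_eq_zero] at h2
    omega
  have h1 : ((2 * m : ℕ) : ℂ) ≠ 1 := by
    rw [Ne, Nat.cast_eq_one]; omega
  rw [riemannZeta_one_sub hne h1]
  have hG : Complex.Gamma ((2 * m : ℕ) : ℂ) = ((2 * m - 1).factorial : ℂ) := by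
    rw [← Complex.Gamma_nat_eq_factorial, Nat.cast_sub (by omega)]
    simp
  have hc : Complex.cos (Real.pi * ((2 * m : ℕ) : ℂ) / 2) = (-1) ^ m := by
    have : (Real.pi * ((2 * m : ℕ) : ℂ) / 2) = ((m * Real.pi : ℝ) : ℂ) := by push_cast; ring
    rw [this, ← Complex.ofReal_cos, Real.cos_nat_mul_pi]
    push_cast; rfl
  rw [hG, hc]

/-- Differentiate the functional equation at `s₀ = 2m + 1`: the cosine vanishes there, so only its
derivative contributes. -/
theorem deriv_riemannZeta_neg_even (m : ℕ) (hm : 0 < m) :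
    deriv riemannZeta (-(2 * m : ℕ)) = (2 * Real.pi) ^ (-((2 * m : ℕ) : ℂ)) *
      ((2 * m).factorial : ℂ) / 2 * (-1) ^ m * riemannZeta ((2 * m : ℕ) + 1) := by
  set s₀ : ℂ := ((2 * m : ℕ) : ℂ) + 1 with hs₀
  have hre : s₀.re = 2 * m + 1 := by simp [hs₀]
  have hm' : (1 : ℝ) ≤ m := by exact_mod_cast hm
  have hpi : (2 * Real.pi : ℂ) ≠ 0 := by simp [Real.pi_ne_zero]
  have hne1 : s₀ ≠ 1 := by
    intro h; rw [h] at hre; simp at hre; linarith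
  have hneg (k : ℕ) : s₀ ≠ -k := by
    intro h; rw [h] at hre; simp at hre
    have : (0 : ℝ) ≤ k := k.cast_nonneg
    linarith
  set B : ℂ → ℂ := fun s => 2 * (2 * Real.pi) ^ (-s) * Complex.Gamma s * riemannZeta s with hB
  have hBd : DifferentiableAt ℂ B s₀ :=
    (((differentiableAt_id.neg.const_cpow (Or.inl hpi)).const_mul 2).mul
      (Complex.differentiableAt_Gamma s₀ hneg)).mul (differentiableAt_riemannZeta hne1)
  have harg : (Real.pi * s₀ / 2 : ℂ) = ((m * Real.pi : ℝ) : ℂ) + Real.pi / 2 := by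
    rw [hs₀]; push_cast; ring
  have hcos : Complex.cos (Real.pi * s₀ / 2) = 0 := by
    rw [harg, Complex.cos_add_pi_div_two, ← Complex.ofReal_sin, Real.sin_nat_mul_pi]
    simp
  have hsin : Complex.sin (Real.pi * s₀ / 2) = (-1) ^ m := by
    rw [harg, Complex.sin_add_pi_div_two, ← Complex.ofReal_cos, Real.cos_nat_mul_pi]
    push_cast; rfl
  have hcd : HasDerivAt (fun s : ℂ => Complex.cos (Real.pi * s / 2))
      (-(-1) ^ m * (Real.pi / 2)) s₀ := by
    have h := (((hasDerivAt_id s₀).const_mul (Real.pi : ℂ)).div_const 2).ccos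
    simp only [id, hsin, mul_one] at h
    exact h
  have hR := hBd.hasDerivAt.mul hcd
  rw [hcos, mul_zero, zero_add] at hR
  have hL : HasDerivAt (fun s => riemannZeta (1 - s))
      (-deriv riemannZeta (-(2 * m : ℕ))) s₀ := by
    have hneg1 : (1 - s₀) = -((2 * m : ℕ) : ℂ) := by rw [hs₀]; ring
    have hd : DifferentiableAt ℂ riemannZeta (1 - s₀) := differentiableAt_riemannZeta (by
      intro h
      have := congrArg Complex.re h
      simp [hre] at this
      linarith)
    have := HasDerivAt.comp_const_sub 1 s₀ hd.hasDerivAt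
    rwa [hneg1] at this
  have hev : (fun s => riemannZeta (1 - s)) =ᶠ[𝓝 s₀]
      (B * fun s : ℂ => Complex.cos (Real.pi * s / 2)) := by
    have ho : IsOpen {s : ℂ | 1 < s.re} := isOpen_lt continuous_const Complex.continuous_re
    filter_upwards [ho.mem_nhds (show s₀ ∈ {s : ℂ | 1 < s.re} by
      simp only [Set.mem_ofPred_eq, hre]; linarith)] with s hs
    have hs' : 1 < s.re := hs
    rw [riemannZeta_one_sub (fun k h => by
      rw [h] at hs'; simp at hs'
      have : (0 : ℝ) ≤ k := k.cast_nonneg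
      linarith) (fun h => by rw [h] at hs'; simp at hs')]
    simp only [hB, Pi.mul_apply]
    ring
  have huniq := hL.unique (hR.congr_of_eventuallyEq hev)
  have hG : Complex.Gamma s₀ = ((2 * m).factorial : ℂ) := Complex.Gamma_nat_eq_factorial (2 * m)
  have hp : (2 * Real.pi : ℂ) ^ (-s₀) * (2 * Real.pi) = (2 * Real.pi) ^ (-((2 * m : ℕ) : ℂ)) := by
    rw [hs₀, neg_add, Complex.cpow_add _ _ hpi, Complex.cpow_neg_one]
    field_simp
  have hBv : B s₀ = 2 * (2 * Real.pi) ^ (-s₀) * ((2 * m).factorial : ℂ) * riemannZeta s₀ := by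
    simp only [hB, hG]
  rw [hBv] at huniq
  rw [← hp]
  linear_combination -huniq

end SpecialValues

/-! ### The quotient formula -/

section Quotient

theorem two_le_of_pos_of_even {n : ℕ} (hn : 0 < n) (he : Even n) : 2 ≤ n := by
  obtain ⟨m, rfl⟩ := he
  omega

theorem riemannZeta_neg_even {n : ℕ} (hn : 0 < n) (he : Even n) : riemannZeta (-n) = 0 := by
  obtain ⟨m, rfl⟩ := he
  obtain ⟨k, rfl⟩ : ∃ k, m = k + 1 := ⟨m - 1, by omega⟩
  rw [← riemannZeta_neg_two_mul_nat_add_one k]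
  congr 1
  push_cast
  ring

theorem riemannZeta_natCast_ne_zero {n : ℕ} (hn : 2 ≤ n) : riemannZeta n ≠ 0 :=
  riemannZeta_ne_zero_of_one_le_re (by simp; omega)

/-- The relation between the values of `ζ'` and `ζ` at consecutive nonpositive integers and the
quotient `ζ(n + 1) / ζ(n)`. -/
theorem four_mul_deriv_riemannZeta_neg {n : ℕ} (hn : 0 < n) (he : Even n) :
    riemannZeta (1 - n) ≠ 0 ∧
    4 * deriv riemannZeta (-n) =
      n * (riemannZeta ((n : ℂ) + 1) / riemannZeta n) * riemannZeta (1 - n) := by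
  obtain ⟨m, rfl⟩ := even_iff_exists_two_mul.mp he
  have hm : 0 < m := by omega
  have hz := riemannZeta_natCast_ne_zero (n := 2 * m) (by omega)
  have hpi : (2 * Real.pi : ℂ) ≠ 0 := by simp [Real.pi_ne_zero]
  have hp : (2 * Real.pi : ℂ) ^ (-((2 * m : ℕ) : ℂ)) ≠ 0 := by
    rw [Complex.cpow_def_of_ne_zero hpi]
    exact Complex.exp_ne_zero _
  have hf : ((2 * m).factorial : ℂ) = ((2 * m : ℕ) : ℂ) * ((2 * m - 1).factorial : ℂ) := by
    exact_mod_cast (Nat.mul_factorial_pred (by omega : 2 * m ≠ 0)).symm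
  have hf0 : ((2 * m - 1).factorial : ℂ) ≠ 0 := by exact_mod_cast Nat.factorial_ne_zero _
  rw [riemannZeta_one_sub_even hm, deriv_riemannZeta_neg_even m hm, hf]
  constructor
  · refine mul_ne_zero (mul_ne_zero (mul_ne_zero (mul_ne_zero two_ne_zero hp) hf0) ?_) hz
    exact pow_ne_zero _ (by norm_num)
  · field_simp
    ring

theorem dpZero_cast {n : ℕ} (hn : 0 < n) (he : Even n) :
    (dpZero n : ℂ) = (n - 1) * (2 ^ n * (1 - 2 ^ n) * riemannZeta (1 - n)) := by
  rw [dpZero_eq hn he]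
  have h := eval_zero_p (n - 1)
  rw [Nat.sub_add_cancel hn, Nat.cast_sub hn, Nat.cast_one, neg_sub] at h
  push_cast
  rw [h]

theorem one_sub_two_pow_ne_zero {n : ℕ} (hn : 0 < n) : (1 - 2 ^ n : ℂ) ≠ 0 := by
  rw [sub_ne_zero]
  exact_mod_cast (Nat.one_lt_two_pow hn.ne').ne

theorem dpZero_ne_zero {n : ℕ} (hn : 0 < n) (he : Even n) : dpZero n ≠ 0 := by
  have h2 := two_le_of_pos_of_even hn he
  have h : (dpZero n : ℂ) ≠ 0 := by
    rw [dpZero_cast hn he]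
    refine mul_ne_zero (sub_ne_zero.mpr (by exact_mod_cast (by omega : n ≠ 1))) (mul_ne_zero
      (mul_ne_zero (pow_ne_zero _ two_ne_zero) (one_sub_two_pow_ne_zero hn))
      (four_mul_deriv_riemannZeta_neg hn he).1)
  exact_mod_cast h

theorem riemannZeta_quotient {n : ℕ} (hn : 0 < n) (he : Even n) :
    riemannZeta ((n : ℂ) + 1) / riemannZeta (n : ℂ) =
      (1 - 1 / (n : ℂ)) * (1 - 1 / ((2 : ℂ) ^ (n + 1) - 1)) *
        (LStarRat (p n) / (dpZero n : ℂ)) := by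
  have h2 := two_le_of_pos_of_even hn he
  obtain ⟨hz, hd⟩ := four_mul_deriv_riemannZeta_neg hn he
  have hn0 : (n : ℂ) ≠ 0 := by exact_mod_cast hn.ne'
  have hn1 : (n : ℂ) - 1 ≠ 0 := sub_ne_zero.mpr (by exact_mod_cast (by omega : n ≠ 1))
  have hp1 := one_sub_two_pow_ne_zero hn
  have hp2 : (2 : ℂ) ^ (n + 1) - 1 ≠ 0 := by
    rw [← neg_sub]; exact neg_ne_zero.mpr (one_sub_two_pow_ne_zero n.succ_pos)
  have hp0 : (2 : ℂ) ^ n ≠ 0 := pow_ne_zero _ two_ne_zero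
  rw [LStarRat_p (riemannZeta_neg_even hn he), dpZero_cast hn he]
  set q := riemannZeta ((n : ℂ) + 1) / riemannZeta (n : ℂ)
  have hd' : deriv riemannZeta (-n) = n * q * riemannZeta (1 - n) / 4 := by
    linear_combination hd / 4
  rw [hd']
  rw [pow_succ] at hp2 ⊢
  generalize (2 : ℂ) ^ n = t at *
  field_simp
  ring

/-- The rational factor relating `ζ(n + 1) / ζ(n)` to `L*(p n)`. -/
noncomputable def quotientCoeff (n : ℕ) : ℚ :=
  (1 - 1 / (n : ℚ)) * (1 - 1 / ((2 : ℚ) ^ (n + 1) - 1)) / dpZero n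

theorem quotientCoeff_ne_zero {n : ℕ} (hn : 0 < n) (he : Even n) : quotientCoeff n ≠ 0 := by
  have h2 := two_le_of_pos_of_even hn he
  refine div_ne_zero (mul_ne_zero ?_ ?_) (dpZero_ne_zero hn he)
  · have : (2 : ℚ) ≤ n := by exact_mod_cast h2
    have : 1 / (n : ℚ) < 1 := by rw [div_lt_one (by linarith)]; linarith
    linarith
  · have h4 : (2 : ℚ) ^ 2 ≤ 2 ^ (n + 1) := pow_le_pow_right₀ (by norm_num) (by omega)
    have : 1 / ((2 : ℚ) ^ (n + 1) - 1) < 1 := by rw [div_lt_one (by linarith)]; linarith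
    linarith

theorem riemannZeta_quotient_eq_quotientCoeff_mul {n : ℕ} (hn : 0 < n) (he : Even n) :
    riemannZeta ((n : ℂ) + 1) / riemannZeta (n : ℂ) = quotientCoeff n * LStarRat (p n) := by
  rw [riemannZeta_quotient hn he, quotientCoeff]
  push_cast
  ring

end Quotient

/-! ### The limit along even `n` -/

section Limit

theorem tendsto_riemannZeta_atTop :
    Tendsto (fun x : ℝ => riemannZeta x) atTop (𝓝 1) := by
  have h := LSeries.tendsto_atTop (f := 1) (by
    rw [LSeries.abscissaOfAbsConv_one]
    exact_mod_cast EReal.coe_lt_top 1)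
  refine h.congr' ?_
  filter_upwards [eventually_gt_atTop 1] with x hx
  exact LSeries_one_eq_riemannZeta (by simpa using hx)

theorem tendsto_riemannZeta_natCast : Tendsto (fun n : ℕ => riemannZeta n) atTop (𝓝 1) := by
  have h := tendsto_riemannZeta_atTop.comp tendsto_natCast_atTop_atTop
  refine h.congr fun n => ?_
  simp

theorem tendsto_LStarRat_div_dpZero :
    Tendsto (fun n : ℕ => LStarRat (p n) / (dpZero n : ℂ))
      (atTop ⊓ 𝓟 {n : ℕ | Even n}) (𝓝 1) := by
  have hz := tendsto_riemannZeta_natCast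
  have hz1 : Tendsto (fun n : ℕ => riemannZeta ((n : ℂ) + 1)) atTop (𝓝 1) :=
    ((tendsto_add_atTop_iff_nat 1).mpr hz).congr fun n => by push_cast; rfl
  have hn : Tendsto (fun n : ℕ => 1 - 1 / (n : ℂ)) atTop (𝓝 1) := by
    simpa using (tendsto_one_div_atTop_nhds_zero_nat (𝕜 := ℂ)).const_sub 1
  have hp : Tendsto (fun n : ℕ => 1 - 1 / ((2 : ℂ) ^ (n + 1) - 1)) atTop (𝓝 1) := by
    have h1 : Tendsto (fun n : ℕ => (1 / 2 : ℂ) ^ (n + 1)) atTop (𝓝 0) :=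
      (tendsto_add_atTop_iff_nat 1).mpr
        (tendsto_pow_atTop_nhds_zero_of_norm_lt_one (by norm_num))
    -- With `x = 2^(-(n+1))`, `1/(2^(n+1) - 1) = x/(1 - x)`.
    have h2 := (h1.div (h1.const_sub 1) (by norm_num)).const_sub 1
    simp only [sub_zero, zero_div] at h2
    refine h2.congr fun n => ?_
    have h0 : (2 : ℂ) ^ (n + 1) ≠ 0 := pow_ne_zero _ two_ne_zero
    have h3 : (2 : ℂ) ^ (n + 1) - 1 ≠ 0 := by
      rw [← neg_sub]; exact neg_ne_zero.mpr (one_sub_two_pow_ne_zero n.succ_pos)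
    simp only [Pi.div_apply]
    rw [one_div_pow]
    field_simp
  have hall := ((hz1.div hz one_ne_zero).div (hn.mul hp) (by norm_num)).mono_left
    (inf_le_left : atTop ⊓ 𝓟 {n : ℕ | Even n} ≤ atTop)
  simp only [div_one, mul_one] at hall
  refine hall.congr' ?_
  have hev : ∀ᶠ n : ℕ in atTop ⊓ 𝓟 {n : ℕ | Even n}, Even n :=
    mem_inf_of_right (mem_principal_self _)
  have hpos : ∀ᶠ n : ℕ in atTop ⊓ 𝓟 {n : ℕ | Even n}, 0 < n :=
    mem_inf_of_left (eventually_gt_atTop 0)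
  filter_upwards [hev, hpos] with n he hn
  have hq := quotientCoeff_ne_zero hn he
  have hc : (1 - 1 / (n : ℂ)) * (1 - 1 / ((2 : ℂ) ^ (n + 1) - 1)) ≠ 0 := by
    intro h
    refine hq ?_
    have : ((quotientCoeff n : ℚ) : ℂ) = 0 := by
      rw [quotientCoeff]
      push_cast
      rw [h, zero_div]
    exact_mod_cast this
  simp only [Pi.div_apply]
  rw [riemannZeta_quotient hn he, mul_div_cancel_left₀ _ hc]

end Limit

/-! ### Rational linear combinations -/

section Combination

theorem summable_LStarRat (f : ℚ[X]) :
    Summable fun n : ℕ => (a (n + 1) : ℂ) *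
      (f.map (algebraMap ℚ ℂ)).eval ((n + 1 : ℕ) : ℂ) :=
  (summable_norm_a_succ_mul_eval _).of_norm

theorem LStarRat_add (f g : ℚ[X]) : LStarRat (f + g) = LStarRat f + LStarRat g := by
  simp only [LStarRat, LStar]
  rw [← (summable_LStarRat f).tsum_add (summable_LStarRat g)]
  refine tsum_congr fun n => ?_
  rw [Polynomial.map_add, eval_add, mul_add]

theorem LStarRat_C_mul (c : ℚ) (f : ℚ[X]) : LStarRat (C c * f) = c * LStarRat f := by
  simp only [LStarRat, LStar]
  rw [← tsum_mul_left]
  refine tsum_congr fun n => ?_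
  rw [Polynomial.map_mul, map_C, eval_mul, eval_C, eq_ratCast]
  ring

theorem LStarRat_sum {ι : Type*} (s : Finset ι) (f : ι → ℚ[X]) :
    LStarRat (∑ i ∈ s, f i) = ∑ i ∈ s, LStarRat (f i) := by
  classical
  induction s using Finset.induction_on with
  | empty => simp [LStarRat, LStar]
  | insert i s hi ih => rw [Finset.sum_insert hi, Finset.sum_insert hi, LStarRat_add, ih]

/-- The degrees `n j` are strictly increasing, so the last term cannot be cancelled. -/
theorem natDegree_sum_C_mul_p (N : ℕ) (c : Fin (N + 1) → ℚ) (n : Fin (N + 1) → ℕ)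
    (hc : c (Fin.last N) ≠ 0) (hn : StrictMono n) :
    (∑ j, C (c j) * p (n j)).natDegree = n (Fin.last N) := by
  have hlast : (C (c (Fin.last N)) * p (n (Fin.last N))).degree = n (Fin.last N) := by
    rw [degree_C_mul hc, degree_eq_natDegree (p_monic_natDegree _).1.ne_zero,
      (p_monic_natDegree _).2]
  have hlt : (∑ j : Fin N, C (c j.castSucc) * p (n j.castSucc)).degree <
      (C (c (Fin.last N)) * p (n (Fin.last N))).degree := by
    rw [hlast]
    refine (degree_sum_le _ _).trans_lt ?_
    rw [Finset.sup_lt_iff (WithBot.bot_lt_coe _)]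
    intro j _
    refine degree_le_natDegree.trans_lt ?_
    refine Nat.cast_lt.mpr ((natDegree_C_mul_le _ _).trans_lt ?_)
    rw [(p_monic_natDegree _).2]
    exact hn (Fin.castSucc_lt_last j)
  rw [Fin.sum_univ_castSucc, natDegree_add_eq_right_of_degree_lt hlt]
  exact natDegree_eq_of_degree_eq_some hlast

end Combination

end QuotZeta

theorem theorem3 :
    -- the series defining `L*` converges absolutely for every complex polynomial
    (∀ f : ℂ[X], Summable
      (fun n : ℕ => ‖(QuotZeta.a (n + 1) : ℂ) * f.eval ((n + 1 : ℕ) : ℂ)‖)) ∧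
    -- the quotient formula, for positive even `n`
    (∀ n : ℕ, 0 < n → Even n →
      QuotZeta.dpZero n ≠ 0 ∧
      riemannZeta ((n : ℂ) + 1) / riemannZeta (n : ℂ) =
        (1 - 1 / (n : ℂ)) * (1 - 1 / ((2 : ℂ) ^ (n + 1) - 1)) *
          (QuotZeta.LStarRat (QuotZeta.p n) / (QuotZeta.dpZero n : ℂ))) ∧
    -- the limit along even `n`
    Tendsto (fun n : ℕ => QuotZeta.LStarRat (QuotZeta.p n) / (QuotZeta.dpZero n : ℂ))
      (atTop ⊓ 𝓟 {n : ℕ | Even n}) (𝓝 1) ∧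
    -- rational linear combinations of `N + 1 ≥ 1` quotients
    (∀ (N : ℕ) (α : Fin (N + 1) → ℚ) (n : Fin (N + 1) → ℕ),
      (∀ j, α j ≠ 0) → (∀ j, 0 < n j ∧ Even (n j)) → StrictMono n →
      ∃ q : ℚ[X], q.natDegree = n (Fin.last N) ∧
        ∑ j, (α j : ℂ) * (riemannZeta ((n j : ℂ) + 1) / riemannZeta (n j : ℂ)) =
          QuotZeta.LStarRat q) := by
  refine ⟨QuotZeta.summable_norm_a_succ_mul_eval, fun n hn he =>
    ⟨QuotZeta.dpZero_ne_zero hn he, QuotZeta.riemannZeta_quotient hn he⟩,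
    QuotZeta.tendsto_LStarRat_div_dpZero, fun N α n hα hn hmono => ?_⟩
  refine ⟨∑ j, C (α j * QuotZeta.quotientCoeff (n j)) * QuotZeta.p (n j),
    QuotZeta.natDegree_sum_C_mul_p N (fun j => α j * QuotZeta.quotientCoeff (n j)) n
      (mul_ne_zero (hα _) (QuotZeta.quotientCoeff_ne_zero (hn _).1 (hn _).2)) hmono, ?_⟩
  rw [QuotZeta.LStarRat_sum]
  refine Finset.sum_congr rfl fun j _ => ?_
  rw [QuotZeta.LStarRat_C_mul, QuotZeta.riemannZeta_quotient_eq_quotientCoeff_mul (hn j).1 (hn j).2]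
  push_cast
  ring
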